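/- Let $\mathcal H$ be a real Hilbert space, $\mathcal D$ a subset of a normed space $\mathcal G$ (with the induced topology), $I_1, I_2$ disjoint finite index sets, and let $g_i:\mathcal D\to\mathcal H$, $f_i:\mathcal D\to\mathbb R$ ($i\in I_1\cup I_2$) be locally Lipschitz. For $p\in\mathcal D$ let $$C(p)=\{x\in\mathcal H : \langle x, g_i(p)\rangle=f_i(p)\ (i\in I_1),\ \langle x, g_i(p)\rangle\le f_i(p)\ (i\in I_2)\},$$ let $I_p(x)=\{i\in I_1\cup I_2:\langle x,g_i(p)\rangle=f_i(p)\}$, and, when $C(p)\ne\emptyset$, let $P(v,p)$ be the projection of $v\in\mathcal H$ onto $C(p)$, i.e. the unique minimizer of $\frac12\|x-v\|^2$ over $x\in C(p)$. For $M>0$ let $\Lambda^M_v(p,x)$ be the set of $\lambda\in\mathbb R^{I_1\cup I_2}$ such that $$v-x=\sum_{i\in I_1\cup I_2}\lambda_i g_i(p),\qquad \lambda_i\ge 0\ \text{ and }\ \lambda_i\big(\langle x,g_i(p)\rangle-f_i(p)\big)=0\ \ (i\in I_2),\qquad \sum_{i\in I_1\cup I_2}|\lambda_i|\le M .$$ Let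 $\bar p\in\mathcal D$ with $C(\bar p)\neq\emptyset$, let $\bar v\in\mathcal H\setminus C(\bar p)$, put $\bar x=P(\bar v,\bar p)$, and assume: 1. (RCRCQ at $(\bar p,\bar x)$) there is a neighbourhood $U_0$ of $\bar p$ in $\mathcal D$ such that $\operatorname{rank}\{g_i(p): i\in J\}=\operatorname{rank}\{g_i(\bar p): i\in J\}$ for all $p\in U_0$ and all $J$ with $I_1\subset J\subset I_{\bar p}(\bar x)$; 2. $\bar x$ lies in the lower Kuratowski limit of $C$ at $\bar p$: for every neighbourhood $V$ of $\bar x$ there is a neighbourhood $U$ of $\bar p$ in $\mathcal D$ such that $V\cap C(p)\ne\emptyset$ for all $p\in U$; 3. there are a set $\bar K\subset I_{\bar p}(\bar x)\cap I_2$ and reals $\bar\lambda_i$ ($i\in I_1\cup\bar K$), with $\bar\lambda_i>0$ for $i\in\bar K$, such that $\bar v-\bar x=\sum_{i\in I_1\cup\bar K}\bar\lambda_i g_i(\bar p)$, and the vectors $g_i(\bar p)$, $i\in I_1\cup\bar K$, are linearly independent. Then there are a neighbourhood $U_1$ of $\bar p$ in $\mathcal D$, a neighbourhood $V_1$ of $0$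 in $\mathcal H$, and $M>0$ such that for all $p\in U_1$ and all $v\in\bar v+V_1$ one has $C(p)\neq\emptyset$ and $\Lambda^M_v(p,P(v,p))\neq\emptyset$. -/

import Mathlib

open Topology

namespace ParamProj

noncomputable section

variable {H : Type*} [NormedAddCommGroup H] [InnerProductSpace ℝ H]
variable {D : Type*}
variable {ι : Type*} [Fintype ι] [DecidableEq ι]

/-- The feasible set `C(p)`: equality constraints `⟨x | g i p⟩ = f i p` for `i ∈ I₁`, and inequality
constraints `⟨x | g i p⟩ ≤ f i p` for the remaining indices `i ∈ I₂ = I₁ᶜ`. -/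
def feasibleSet (I₁ : Finset ι) (g : ι → D → H) (f : ι → D → ℝ) (p : D) : Set H :=
  {x | (∀ i ∈ I₁, inner ℝ x (g i p) = f i p) ∧ (∀ i ∈ I₁ᶜ, inner ℝ x (g i p) ≤ f i p)}

/-- The set `I_p(x)` of indices (of both kinds) that are active for `p` at `x`. -/
def activeSet (g : ι → D → H) (f : ι → D → ℝ) (p : D) (x : H) : Set ι :=
  {i | inner ℝ x (g i p) = f i p}

/-- `x` solves the problem of minimizing `½‖x - v‖²` over `x ∈ S`. -/
def IsSolution (S : Set H) (v x : H) : Prop :=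
  x ∈ S ∧ IsMinOn (fun y : H => (1 / 2 : ℝ) * ‖y - v‖ ^ 2) S x

/-- The projection `P_S(v)`: the solution of the problem of minimizing `½‖x - v‖²` over `x ∈ S`.
It exists and is unique when `S` is a feasible set that is not empty: `isSolution_iff_eq_proj`. -/
def proj (S : Set H) (v : H) : H :=
  Classical.epsilon (IsSolution S v)

/-- The lower Kuratowski limit of `F` at `p₀`: the points `y` each neighbourhood of which meets
`F p` for all `p` near `p₀`. -/
def lowerLimit [TopologicalSpace D] (F : D → Set H) (p₀ : D) : Set H :=
  {y | ∀ V ∈ 𝓝 y, ∃ U ∈ 𝓝 p₀, ∀ p ∈ U, (V ∩ F p).Nonempty}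

/-- The relaxed constant rank constraint qualification at `(p₀, x₀)`, `x₀ ∈ C(p₀)`. The rank of a
system of vectors is the dimension of its span. -/
def RCRCQ [TopologicalSpace D] (I₁ : Finset ι) (g : ι → D → H) (f : ι → D → ℝ)
    (p₀ : D) (x₀ : H) : Prop :=
  x₀ ∈ feasibleSet I₁ g f p₀ ∧
    ∃ U ∈ 𝓝 p₀, ∀ J : Finset ι, I₁ ⊆ J → (J : Set ι) ⊆ activeSet g f p₀ x₀ → ∀ p ∈ U,
      Set.finrank ℝ ((fun i => g i p) '' (J : Set ι)) =
        Set.finrank ℝ ((fun i => g i p₀) '' (J : Set ι))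

/-- The set `Λ_v(p, x)` of Lagrange multipliers: stationarity, signs and complementary slackness
for the inequality constraints. -/
def multipliers (I₁ : Finset ι) (g : ι → D → H) (f : ι → D → ℝ) (v : H) (p : D) (x : H) :
    Set (ι → ℝ) :=
  {l | v - x = ∑ i, l i • g i p ∧
    ∀ i ∈ I₁ᶜ, 0 ≤ l i ∧ l i * (inner ℝ x (g i p) - f i p) = 0}

/-- The set `Λ_v^M(p, x)` of Lagrange multipliers whose `ℓ¹`-norm is at most `M`. -/
def boundedMultipliers (I₁ : Finset ι) (g : ι → D → H) (f : ι → D → ℝ) (M : ℝ) (v : H) (p : D)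
    (x : H) : Set (ι → ℝ) :=
  {l | l ∈ multipliers I₁ g f v p x ∧ ∑ i, |l i| ≤ M}

theorem convex_feasibleSet (I₁ : Finset ι) (g : ι → D → H) (f : ι → D → ℝ) (p : D) :
    Convex ℝ (feasibleSet I₁ g f p) := by
  rintro x ⟨hx, hx'⟩ y ⟨hy, hy'⟩ a b ha hb hab
  refine ⟨fun i hi => ?_, fun i hi => ?_⟩
  · rw [inner_add_left, real_inner_smul_left, real_inner_smul_left, hx i hi, hy i hi,
      ← add_mul, hab, one_mul]
  · rw [inner_add_left, real_inner_smul_left, real_inner_smul_left]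
    have h1 := mul_le_mul_of_nonneg_left (hx' i hi) ha
    have h2 := mul_le_mul_of_nonneg_left (hy' i hi) hb
    have h3 : a * f i p + b * f i p = f i p := by rw [← add_mul, hab, one_mul]
    linarith

theorem isClosed_feasibleSet (I₁ : Finset ι) (g : ι → D → H) (f : ι → D → ℝ) (p : D) :
    IsClosed (feasibleSet I₁ g f p) := by
  simp only [feasibleSet, Set.ofPred_and, Set.ofPred_forall]
  refine IsClosed.inter ?_ ?_
  · exact isClosed_iInter fun i => isClosed_iInter fun _ =>
      isClosed_eq (by fun_prop) continuous_const
  · exact isClosed_iInter fun i => isClosed_iInter fun _ =>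
      isClosed_le (by fun_prop) continuous_const

theorem isSolution_iff (S : Set H) (v x : H) :
    IsSolution S v x ↔ x ∈ S ∧ ∀ y ∈ S, ‖x - v‖ ≤ ‖y - v‖ := by
  refine and_congr_right fun _ => forall₂_congr fun y _ => ?_
  change (1 / 2 : ℝ) * ‖x - v‖ ^ 2 ≤ (1 / 2 : ℝ) * ‖y - v‖ ^ 2 ↔ _
  rw [mul_le_mul_iff_right₀ (by norm_num), sq_le_sq₀ (norm_nonneg _) (norm_nonneg _)]

/-- The projection onto a nonempty feasible set is the unique solution of the minimization
problem. -/
theorem isSolution_iff_eq_proj [CompleteSpace H] (I₁ : Finset ι) (g : ι → D → H)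
    (f : ι → D → ℝ) (p : D) (hne : (feasibleSet I₁ g f p).Nonempty) (v x : H) :
    IsSolution (feasibleSet I₁ g f p) v x ↔ x = proj (feasibleSet I₁ g f p) v := by
  have hconv := convex_feasibleSet I₁ g f p
  have hcl := isClosed_feasibleSet I₁ g f p
  generalize feasibleSet I₁ g f p = S at hne hconv hcl ⊢
  have key : ∀ z, IsSolution S v z → ∀ w ∈ S, inner ℝ (v - z) (w - z) ≤ 0 := by
    intro z hz
    rw [isSolution_iff] at hz
    refine (norm_eq_iInf_iff_real_inner_le_zero hconv hz.1).1 (le_antisymm ?_ ?_)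
    · have : Nonempty S := ⟨⟨z, hz.1⟩⟩
      refine le_ciInf fun w => ?_
      rw [norm_sub_rev v z, norm_sub_rev v (w : H)]
      exact hz.2 w w.2
    · exact ciInf_le ⟨0, by rintro _ ⟨w, rfl⟩; exact norm_nonneg _⟩ (⟨z, hz.1⟩ : S)
  have huniq : ∀ y z, IsSolution S v y → IsSolution S v z → y = z := by
    intro y z hy hz
    have h1 := key y hy z hz.1
    have h2 := key z hz y hy.1
    have h3 : inner ℝ (y - z) (y - z) ≤ (0 : ℝ) := by
      simp only [inner_sub_left, inner_sub_right] at h1 h2 ⊢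
      linarith
    rw [real_inner_self_eq_norm_sq] at h3
    have h4 : ‖y - z‖ = 0 := by nlinarith [norm_nonneg (y - z)]
    exact sub_eq_zero.1 (norm_eq_zero.1 h4)
  have hex : ∃ z, IsSolution S v z := by
    obtain ⟨z, hz, hmin⟩ := exists_norm_eq_iInf_of_complete_convex hne hcl.isComplete hconv v
    refine ⟨z, (isSolution_iff S v z).2 ⟨hz, fun y hy => ?_⟩⟩
    rw [norm_sub_rev z v, norm_sub_rev y v, hmin]
    exact ciInf_le ⟨0, by rintro _ ⟨w, rfl⟩; exact norm_nonneg _⟩ (⟨y, hy⟩ : S)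
  have hproj : IsSolution S v (proj S v) := Classical.epsilon_spec hex
  exact ⟨fun h => huniq _ _ h hproj, fun h => h ▸ hproj⟩

end

end ParamProj

/-! The projection is continuous at the base point, and near it the multipliers can be chosen on
linearly independent systems, of which there are finitely many. Continuity: the sign condition on
`l₀` makes `⟪x - x₀, v₀ - x₀⟫` nonpositive up to a small error for every `x` feasible at a nearby
`p`, hence `‖x - x₀‖²` is controlled by `‖x - v₀‖² - ‖x₀ - v₀‖²`. The lower limit supplies feasible
points near `x₀`, which keep this difference small for the projection (`tendsto_proj`). Multipliers:
constant rank keeps the equality gradients independent near `p₀`, so the cone of active gradients is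
closed and the KKT conditions hold. Carathéodory reduces the support to an independent `J ⊇ I₁`. By
continuity `J` is active at `(p₀, x₀)`, so constant rank makes it independent at `p₀` too, where a
bound depending only on `J` is stable under perturbation. -/

namespace ParamProj

open Filter

/-! ### Finitely generated cones: Carathéodory, closedness, Farkas. -/

section Cone

variable {H : Type*} [NormedAddCommGroup H] [InnerProductSpace ℝ H]
variable {ι : Type*} [Fintype ι]

/-- The linear combinations of the vectors `a i`, `i ∈ J`, with coefficients that are nonnegative
outside of `I`. -/
def mixedCone (a : ι → H) (I J : Finset ι) : Set H :=
  {z | ∃ l : ι → ℝ, (∀ i ∉ J, l i = 0) ∧ (∀ i ∉ I, 0 ≤ l i) ∧ z = ∑ i, l i • a i}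

theorem sum_smul_eq_of_support (a : ι → H) {J : Finset ι} {l : ι → ℝ} (hl : ∀ i ∉ J, l i = 0) :
    ∑ i, l i • a i = ∑ i ∈ J, l i • a i :=
  (Finset.sum_subset (Finset.subset_univ J) fun i _ hi => by rw [hl i hi, zero_smul]).symm

theorem mixedCone_mono (a : ι → H) (I : Finset ι) {J J' : Finset ι} (h : J ⊆ J') :
    mixedCone a I J ⊆ mixedCone a I J' := by
  rintro z ⟨l, hl, hl', rfl⟩
  exact ⟨l, fun i hi => hl i fun hi' => hi (h hi'), hl', rfl⟩

/-- A linear dependence on `J` lets one remove an index outside of `I` from a representation. -/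
theorem exists_mem_mixedCone_erase [DecidableEq ι] {a : ι → H} {I J : Finset ι} (hIJ : I ⊆ J)
    (hI : LinearIndepOn ℝ a (I : Set ι)) (hJ : ¬ LinearIndepOn ℝ a (J : Set ι)) {z : H}
    (hz : z ∈ mixedCone a I J) : ∃ j ∈ J, j ∉ I ∧ z ∈ mixedCone a I (J.erase j) := by
  obtain ⟨l, hl, hl', rfl⟩ := hz
  obtain ⟨m, hm, hm0, k, hkI, hk⟩ : ∃ m : ι → ℝ, (∀ i ∉ J, m i = 0) ∧ ∑ i, m i • a i = 0 ∧
      ∃ k, k ∉ I ∧ 0 < m k := by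
    -- Independence on `I` forces a nonzero coefficient `c k` outside `I`; multiplying the relation
    -- by `c k` makes that coefficient positive.
    obtain ⟨c, hc, k₀, hk₀, hck₀⟩ := not_linearIndepOn_finset_iff.1 hJ
    obtain ⟨k, hkJ, hkI, hck⟩ : ∃ k ∈ J, k ∉ I ∧ c k ≠ 0 := by
      by_contra! h
      have hs : ∑ i ∈ I, c i • a i = 0 := by
        rw [← hc]
        exact Finset.sum_subset hIJ fun i hi hi' => by rw [h i hi hi', zero_smul]
      have hc0 := linearIndepOn_finset_iff.1 hI c hs
      by_cases hk : k₀ ∈ I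
      · exact hck₀ (hc0 k₀ hk)
      · exact hck₀ (h k₀ hk₀ hk)
    refine ⟨fun i => if i ∈ J then c k * c i else 0, fun i hi => if_neg hi, ?_, k, hkI, ?_⟩
    · rw [sum_smul_eq_of_support a (J := J) fun i hi => if_neg hi]
      calc _ = ∑ i ∈ J, c k • c i • a i :=
            Finset.sum_congr rfl fun i hi => by rw [if_pos hi, mul_smul]
        _ = 0 := by rw [← Finset.smul_sum, hc, smul_zero]
    · simp only [if_pos hkJ]
      exact mul_self_pos.2 hck
  -- Ratio test: subtracting `(l j / m j) • m` with the smallest ratio cancels index `j` and keeps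
  -- the coefficients outside `I` nonnegative.
  obtain ⟨j, hj, hmin⟩ := (Finset.univ.filter fun i => i ∉ I ∧ 0 < m i).exists_min_image
    (fun i => l i / m i) ⟨k, by simp [hkI, hk]⟩
  simp only [Finset.mem_filter, Finset.mem_univ, true_and] at hj hmin
  have hjJ : j ∈ J := by
    by_contra h
    exact hj.2.ne' (hm j h)
  refine ⟨j, hjJ, hj.1, fun i => l i - l j / m j * m i, fun i hi => ?_, fun i hi => ?_, ?_⟩
  · by_cases hij : i = j
    · subst hij
      have := hj.2.ne'
      field_simp
      ring
    · have hiJ : i ∉ J := fun h => hi (Finset.mem_erase.2 ⟨hij, h⟩)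
      simp only [hl i hiJ, hm i hiJ, mul_zero, sub_zero]
  · have ht : 0 ≤ l j / m j := div_nonneg (hl' j hj.1) hj.2.le
    rcases lt_or_ge 0 (m i) with hmi | hmi
    · have := (le_div_iff₀ hmi).1 (hmin i ⟨hi, hmi⟩)
      exact sub_nonneg.2 this
    · have h1 := mul_nonpos_of_nonneg_of_nonpos ht hmi
      have h2 := hl' i hi
      linarith
  · simp only [sub_smul, mul_smul, Finset.sum_sub_distrib]
    rw [← Finset.smul_sum, hm0, smul_zero, sub_zero]

/-- Carathéodory's theorem for mixed cones. -/
theorem exists_linearIndepOn_of_mem_mixedCone {a : ι → H} {I J : Finset ι} (hIJ : I ⊆ J)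
    (hI : LinearIndepOn ℝ a (I : Set ι)) {z : H} (hz : z ∈ mixedCone a I J) :
    ∃ J' : Finset ι, I ⊆ J' ∧ J' ⊆ J ∧ LinearIndepOn ℝ a (J' : Set ι) ∧ z ∈ mixedCone a I J' := by
  classical
  induction J using Finset.strongInduction with
  | H J ih =>
    by_cases hJ : LinearIndepOn ℝ a (J : Set ι)
    · exact ⟨J, hIJ, subset_rfl, hJ, hz⟩
    · obtain ⟨j, hj, hjI, hz'⟩ := exists_mem_mixedCone_erase hIJ hI hJ hz
      obtain ⟨J', h1, h2, h3⟩ := ih (J.erase j) (Finset.erase_ssubset hj)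
        (fun i hi => Finset.mem_erase.2 ⟨fun h => hjI (h ▸ hi), hIJ hi⟩) hz'
      exact ⟨J', h1, h2.trans (Finset.erase_subset j J), h3⟩

/-- Independence makes the coefficient map a closed embedding of a finite-dimensional space, and the
sign conditions cut out a closed set there. -/
theorem isClosed_mixedCone_of_linearIndepOn {a : ι → H} {I J : Finset ι}
    (hJ : LinearIndepOn ℝ a (J : Set ι)) : IsClosed (mixedCone a I J) := by
  classical
  let T : (J → ℝ) →ₗ[ℝ] H := Fintype.linearCombination ℝ fun i : J => a i
  have hT : IsClosedEmbedding T := LinearMap.isClosedEmbedding_of_injective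
    (LinearMap.ker_eq_bot.2 (LinearIndependent.fintypeLinearCombination_injective hJ))
  have hS : IsClosed {c : J → ℝ | ∀ i : J, (i : ι) ∉ I → 0 ≤ c i} := by
    simp only [Set.ofPred_forall]
    exact isClosed_iInter fun i => isClosed_iInter fun _ =>
      isClosed_le continuous_const (continuous_apply i)
  convert hT.isClosedMap _ hS using 1
  ext z
  constructor
  · rintro ⟨l, hl, hl', rfl⟩
    refine ⟨fun i => l i, fun i hi => hl' i hi, ?_⟩
    rw [sum_smul_eq_of_support a hl, Fintype.linearCombination_apply]
    exact Finset.sum_coe_sort J fun i => l i • a i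
  · rintro ⟨c, hc, rfl⟩
    have h0 : ∀ i ∉ J, (if h : i ∈ J then c ⟨i, h⟩ else 0) = 0 := fun i hi => dif_neg hi
    refine ⟨fun i => if h : i ∈ J then c ⟨i, h⟩ else 0, h0, fun i hi => ?_, ?_⟩
    · by_cases h : i ∈ J
      · simpa [h] using hc ⟨i, h⟩ hi
      · simp [h]
    · rw [sum_smul_eq_of_support a h0, Fintype.linearCombination_apply, ← Finset.sum_coe_sort J]
      exact Finset.sum_congr rfl fun i _ => by simp

/-- By Carathéodory the cone is a finite union of cones over independent systems. -/
theorem isClosed_mixedCone {a : ι → H} {I J : Finset ι} (hIJ : I ⊆ J)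
    (hI : LinearIndepOn ℝ a (I : Set ι)) : IsClosed (mixedCone a I J) := by
  have h : mixedCone a I J =
      ⋃ J' ∈ {J' : Finset ι | J' ⊆ J ∧ LinearIndepOn ℝ a (J' : Set ι)}, mixedCone a I J' := by
    ext z
    simp only [Set.mem_iUnion]
    constructor
    · intro hz
      obtain ⟨J', -, h2, h3, h4⟩ := exists_linearIndepOn_of_mem_mixedCone hIJ hI hz
      exact ⟨J', ⟨h2, h3⟩, h4⟩
    · rintro ⟨J', ⟨h2, -⟩, h4⟩
      exact mixedCone_mono a I h2 h4
  rw [h]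
  exact (Set.toFinite _).isClosed_biUnion fun J' hJ' => isClosed_mixedCone_of_linearIndepOn hJ'.2

theorem convex_mixedCone (a : ι → H) (I J : Finset ι) : Convex ℝ (mixedCone a I J) := by
  rintro _ ⟨l, hl, hl', rfl⟩ _ ⟨m, hm, hm', rfl⟩ s t hs ht -
  refine ⟨fun i => s * l i + t * m i, fun i hi => ?_, fun i hi => ?_, ?_⟩
  · simp [hl i hi, hm i hi]
  · have := hl' i hi
    have := hm' i hi
    positivity
  · simp only [add_smul, mul_smul, Finset.sum_add_distrib, Finset.smul_sum]

/-- Farkas' lemma for mixed cones, in projection form. -/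
theorem exists_mem_mixedCone_sub_orthogonal [CompleteSpace H] {a : ι → H} {I J : Finset ι}
    (hIJ : I ⊆ J) (hI : LinearIndepOn ℝ a (I : Set ι)) (u : H) :
    ∃ z ∈ mixedCone a I J, inner ℝ (u - z) z = 0 ∧ (∀ i ∈ I, inner ℝ (u - z) (a i) = 0) ∧
      ∀ i ∈ J, inner ℝ (u - z) (a i) ≤ 0 := by
  classical
  obtain ⟨z, hz, hmin⟩ := exists_norm_eq_iInf_of_complete_convex
    (K := mixedCone a I J) ⟨0, 0, by simp⟩ (isClosed_mixedCone hIJ hI).isComplete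
    (convex_mixedCone a I J) u
  have hvar := (norm_eq_iInf_iff_real_inner_le_zero (convex_mixedCone a I J) hz).1 hmin
  obtain ⟨l, hl, hl', hzl⟩ := id hz
  -- With `z` the projection of `u` onto the cone, the variational inequality is tested at `z + s •
  -- a i`; both signs of `s` are allowed for `i ∈ I`. Testing at `2 • z` and `0` gives orthogonality
  -- to `z`.
  have hadd : ∀ i ∈ J, ∀ s : ℝ, (i ∉ I → 0 ≤ s) → s * inner ℝ (u - z) (a i) ≤ 0 := by
    intro i hi s hs
    have := hvar (z + s • a i) ⟨fun k => l k + if k = i then s else 0, fun k hk => ?_,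
      fun k hk => ?_, ?_⟩
    · rwa [add_sub_cancel_left, real_inner_smul_right] at this
    · have : k ≠ i := fun h => hk (h ▸ hi)
      simp [hl k hk, this]
    · refine add_nonneg (hl' k hk) ?_
      split_ifs with h
      · exact hs (h ▸ hk)
      · rfl
    · simp [add_smul, Finset.sum_add_distrib, hzl]
  refine ⟨z, hz, le_antisymm ?_ ?_, fun i hi => ?_, fun i hi => ?_⟩
  · have := hvar ((2 : ℝ) • z) ⟨fun i => 2 * l i, fun i hi => by simp [hl i hi],
      fun i hi => mul_nonneg zero_le_two (hl' i hi), by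
        rw [hzl, Finset.smul_sum]; simp only [mul_smul]⟩
    rwa [two_smul, add_sub_cancel_left] at this
  · have := hvar 0 ⟨0, by simp⟩
    rw [zero_sub, inner_neg_right] at this
    linarith
  · have h1 := hadd i (hIJ hi) 1 fun h => absurd hi h
    have h2 := hadd i (hIJ hi) (-1) fun h => absurd hi h
    linarith
  · have := hadd i hi 1 fun _ => zero_le_one
    linarith

end Cone

/-! ### Coefficient bounds and their stability. -/

section Perturbation

variable {H : Type*} [NormedAddCommGroup H] [InnerProductSpace ℝ H]
variable {ι : Type*} [Fintype ι]

theorem exists_sum_abs_le_of_linearIndepOn {a : ι → H} {J : Finset ι}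
    (hJ : LinearIndepOn ℝ a (J : Set ι)) :
    ∃ M : ℝ, 0 < M ∧ ∀ l : ι → ℝ, (∀ i ∉ J, l i = 0) → ∑ i, |l i| ≤ M * ‖∑ i, l i • a i‖ := by
  obtain ⟨K, hK, hanti⟩ := LinearMap.exists_antilipschitzWith
    (Fintype.linearCombination ℝ fun i : J => a i)
    (LinearMap.ker_eq_bot.2 (LinearIndependent.fintypeLinearCombination_injective hJ))
  -- Each coefficient is at most `K` times the norm of the sum; the extra `1` keeps the constant
  -- positive for empty `J`.
  refine ⟨(J.card + 1) * K, by positivity, fun l hl => ?_⟩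
  have h := hanti.le_mul_dist (fun i : J => l i) 0
  rw [map_zero, dist_zero_right, dist_zero_right, Fintype.linearCombination_apply,
    Finset.sum_coe_sort J fun i => l i • a i, ← sum_smul_eq_of_support a hl] at h
  calc ∑ i, |l i| = ∑ i ∈ J, |l i| :=
        (Finset.sum_subset (Finset.subset_univ J) fun i _ hi => by rw [hl i hi, abs_zero]).symm
    _ ≤ ∑ i ∈ J, K * ‖∑ i, l i • a i‖ := Finset.sum_le_sum fun i hi =>
        (norm_le_pi_norm (fun i : J => l i) ⟨i, hi⟩).trans h
    _ = J.card * (K * ‖∑ i, l i • a i‖) := by rw [Finset.sum_const, nsmul_eq_mul]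
    _ ≤ (J.card + 1) * K * ‖∑ i, l i • a i‖ := by
        have : 0 ≤ (K : ℝ) * ‖∑ i, l i • a i‖ := by positivity
        linarith

/-- Moving each vector by less than `1 / (2 * M)` costs at most half of `∑ i, |l i|`, which is
absorbed on the left by doubling `M`. -/
theorem exists_eventually_sum_abs_le {D : Type*} [TopologicalSpace D] {g : ι → D → H} {p₀ : D}
    (hg : ∀ i, ContinuousAt (g i) p₀) {J : Finset ι}
    (hJ : LinearIndepOn ℝ (fun i => g i p₀) (J : Set ι)) :
    ∃ M : ℝ, 0 < M ∧ ∀ᶠ p in 𝓝 p₀, ∀ l : ι → ℝ, (∀ i ∉ J, l i = 0) →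
      ∑ i, |l i| ≤ M * ‖∑ i, l i • g i p‖ := by
  obtain ⟨M, hM, hle⟩ := exists_sum_abs_le_of_linearIndepOn hJ
  refine ⟨2 * M, by positivity, ?_⟩
  have hev : ∀ᶠ p in 𝓝 p₀, ∀ i, ‖g i p - g i p₀‖ < 1 / (2 * M) := by
    refine eventually_all.2 fun i => ?_
    have := Metric.tendsto_nhds.1 (hg i) (1 / (2 * M)) (by positivity)
    simpa only [dist_eq_norm] using this
  filter_upwards [hev] with p hp l hl
  have h1 : ‖∑ i, l i • g i p₀‖ ≤ ‖∑ i, l i • g i p‖ + (∑ i, |l i|) * (1 / (2 * M)) := by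
    have : ∑ i, l i • g i p₀ = ∑ i, l i • g i p - ∑ i, l i • (g i p - g i p₀) := by
      simp only [smul_sub, Finset.sum_sub_distrib, sub_sub_cancel]
    rw [this]
    refine (norm_sub_le _ _).trans (add_le_add le_rfl ((norm_sum_le _ _).trans ?_))
    rw [Finset.sum_mul]
    refine Finset.sum_le_sum fun i _ => ?_
    rw [norm_smul, Real.norm_eq_abs]
    exact mul_le_mul_of_nonneg_left (hp i).le (abs_nonneg _)
  have h2 := (hle l hl).trans (mul_le_mul_of_nonneg_left h1 hM.le)
  have h3 : M * (‖∑ i, l i • g i p‖ + (∑ i, |l i|) * (1 / (2 * M))) =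
      M * ‖∑ i, l i • g i p‖ + (∑ i, |l i|) / 2 := by
    field_simp
  linarith

/-- Independence on `J` says that the rank equals `J.card`. This carries independence from `p₀` to
`p` for `I₁`, and back from `p` to `p₀` for the reduced support. -/
theorem linearIndepOn_of_finrank_eq {ι : Type*} {a b : ι → H} {J : Finset ι}
    (h : Set.finrank ℝ (a '' (J : Set ι)) = Set.finrank ℝ (b '' (J : Set ι)))
    (ha : LinearIndepOn ℝ a (J : Set ι)) : LinearIndepOn ℝ b (J : Set ι) := by
  have key : ∀ c : ι → H, LinearIndepOn ℝ c (J : Set ι) ↔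
      J.card = Set.finrank ℝ (c '' (J : Set ι)) := by
    intro c
    have hr : Set.range (fun i : (J : Set ι) => c i) = c '' (J : Set ι) := by
      rw [Set.image_eq_range]
    rw [← hr, LinearIndepOn, linearIndependent_iff_card_eq_finrank_span]
    simp
  rw [key] at ha ⊢
  exact ha.trans h

end Perturbation

/-! ### KKT conditions and continuity of the projection. -/

section Projection

variable {H : Type*} [NormedAddCommGroup H] [InnerProductSpace ℝ H]
variable {D ι : Type*} [Fintype ι] [DecidableEq ι]

/-- The Karush-Kuhn-Tucker conditions for the projection onto a feasible set. -/
theorem sub_mem_mixedCone_of_isSolution [CompleteSpace H] {I₁ : Finset ι} {g : ι → D → H}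
    {f : ι → D → ℝ} {p : D} {v x : H} (hx : IsSolution (feasibleSet I₁ g f p) v x)
    (hI : LinearIndepOn ℝ (fun i => g i p) (I₁ : Set ι)) {J : Finset ι}
    (hJ : ∀ i, i ∈ J ↔ i ∈ activeSet g f p x) : v - x ∈ mixedCone (fun i => g i p) I₁ J := by
  have hxC := hx.1
  rw [isSolution_iff] at hx
  have hmin : ‖v - x‖ = ⨅ w : feasibleSet I₁ g f p, ‖v - w‖ := by
    have : Nonempty (feasibleSet I₁ g f p) := ⟨⟨x, hxC⟩⟩
    refine le_antisymm (le_ciInf fun w => ?_)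
      (ciInf_le ⟨0, by rintro _ ⟨w, rfl⟩; exact norm_nonneg _⟩ (⟨x, hxC⟩ : feasibleSet I₁ g f p))
    rw [norm_sub_rev v x, norm_sub_rev v (w : H)]
    exact hx.2 w w.2
  have hvar := (norm_eq_iInf_iff_real_inner_le_zero (convex_feasibleSet I₁ g f p) hxC).1 hmin
  have hIJ : I₁ ⊆ J := fun i hi => (hJ i).2 (hxC.1 i hi)
  obtain ⟨z, hz, hzz, hzI, hzJ⟩ := exists_mem_mixedCone_sub_orthogonal hIJ hI (v - x)
  -- The residual `y` is a feasible direction at `x`: it respects the active constraints, and the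
  -- inactive ones are strict, so they survive a small step. Optimality then gives `⟪v - x, y⟫ ≤ 0`,
  -- while `y ⊥ z` makes this product `‖y‖ ^ 2`.
  set y := v - x - z with hy
  have hcurve : ∀ i, i ∉ J → ∀ᶠ t : ℝ in 𝓝[>] 0, inner ℝ (x + t • y) (g i p) < f i p := by
    intro i hi
    have hlt : inner ℝ x (g i p) < f i p :=
      lt_of_le_of_ne (hxC.2 i (Finset.mem_compl.2 fun h => hi (hIJ h)))
        fun h => hi ((hJ i).2 h)
    have hc : Tendsto (fun t : ℝ => inner ℝ (x + t • y) (g i p)) (𝓝 0)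
        (𝓝 (inner ℝ (x + (0 : ℝ) • y) (g i p))) := by
      have : Continuous fun t : ℝ => inner ℝ (x + t • y) (g i p) := by fun_prop
      exact this.tendsto 0
    rw [zero_smul, add_zero] at hc
    exact (hc.eventually_lt_const hlt).filter_mono nhdsWithin_le_nhds
  have hev : ∀ᶠ t : ℝ in 𝓝[>] 0, ∀ i, i ∉ J → inner ℝ (x + t • y) (g i p) < f i p :=
    eventually_all.2 fun i => by
      by_cases h : i ∈ J
      · exact Eventually.of_forall fun t h' => absurd h h'
      · filter_upwards [hcurve i h] with t ht _ using ht
  obtain ⟨t, ht, ht0⟩ := (hev.and self_mem_nhdsWithin).exists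
  have ht0 : 0 < t := ht0
  have hmem : x + t • y ∈ feasibleSet I₁ g f p := by
    refine ⟨fun i hi => ?_, fun i hi => ?_⟩
    · rw [inner_add_left, real_inner_smul_left, hzI i hi, mul_zero, add_zero, hxC.1 i hi]
    · by_cases h : i ∈ J
      · rw [inner_add_left, real_inner_smul_left]
        have := mul_nonpos_of_nonneg_of_nonpos ht0.le (hzJ i h)
        linarith [hxC.2 i hi]
      · exact (ht i h).le
  have h1 := hvar _ hmem
  rw [add_sub_cancel_left, real_inner_smul_right] at h1
  have h2 : inner ℝ (v - x) y ≤ 0 := nonpos_of_mul_nonpos_right h1 ht0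
  have h3 : inner ℝ (v - x) y = ‖y‖ ^ 2 := by
    rw [← real_inner_self_eq_norm_sq]
    nth_rewrite 1 [show v - x = y + z by rw [hy]; abel]
    rw [inner_add_left, real_inner_comm y z, hzz, add_zero]
  have h4 : y = 0 := by
    rw [← norm_eq_zero]
    nlinarith [norm_nonneg y]
  rw [hy, sub_eq_zero] at h4
  rwa [h4]

/-- If `v₀ - x₀` is a combination of gradients of constraints that are active at `x₀`, then a point
that is feasible for a nearby parameter and almost as close to `v₀` as `x₀` is close to `x₀`. -/
theorem norm_sub_sq_le_of_mem_feasibleSet {I₁ : Finset ι} {g : ι → D → H} {f : ι → D → ℝ}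
    {p₀ p : D} {v₀ x₀ x : H} {K : Finset ι} {l : ι → ℝ}
    (hact : ∀ i ∈ I₁ ∪ K, inner ℝ x₀ (g i p₀) = f i p₀) (hl : ∀ i ∈ K, 0 ≤ l i)
    (hrep : v₀ - x₀ = ∑ i ∈ I₁ ∪ K, l i • g i p₀) (hx : x ∈ feasibleSet I₁ g f p) :
    ‖x - x₀‖ ^ 2 ≤ ‖x - v₀‖ ^ 2 - ‖x₀ - v₀‖ ^ 2 +
      2 * ∑ i ∈ I₁ ∪ K, |l i| * (‖x‖ * ‖g i p - g i p₀‖ + |f i p - f i p₀|) := by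
  have h1 : inner ℝ (x - x₀) (v₀ - x₀) ≤
      ∑ i ∈ I₁ ∪ K, |l i| * (‖x‖ * ‖g i p - g i p₀‖ + |f i p - f i p₀|) := by
    rw [hrep, inner_sum]
    refine Finset.sum_le_sum fun i hi => ?_
    rw [real_inner_smul_right, inner_sub_left, hact i hi]
    -- The constraint at `p` has the right sign after weighting by `l i`; the rest is the error of
    -- replacing `p` by `p₀`.
    have hsplit : inner ℝ x (g i p₀) - f i p₀ =
        (inner ℝ x (g i p) - f i p) + (f i p - f i p₀ - inner ℝ x (g i p - g i p₀)) := by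
      rw [inner_sub_right]; ring
    have hle : l i * (inner ℝ x (g i p) - f i p) ≤ 0 := by
      by_cases hi₁ : i ∈ I₁
      · rw [hx.1 i hi₁, sub_self, mul_zero]
      · have hiK : i ∈ K := (Finset.mem_union.1 hi).resolve_left hi₁
        exact mul_nonpos_of_nonneg_of_nonpos (hl i hiK)
          (sub_nonpos.2 (hx.2 i (Finset.mem_compl.2 hi₁)))
    have habs : |f i p - f i p₀ - inner ℝ x (g i p - g i p₀)| ≤
        ‖x‖ * ‖g i p - g i p₀‖ + |f i p - f i p₀| := by
      refine (abs_sub _ _).trans ?_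
      rw [add_comm]
      exact add_le_add (abs_real_inner_le_norm _ _) le_rfl
    have h2 : l i * (f i p - f i p₀ - inner ℝ x (g i p - g i p₀)) ≤
        |l i| * (‖x‖ * ‖g i p - g i p₀‖ + |f i p - f i p₀|) := by
      refine (le_abs_self _).trans ?_
      rw [abs_mul]
      exact mul_le_mul_of_nonneg_left habs (abs_nonneg _)
    rw [hsplit, mul_add]
    linarith
  have h2 : ‖x - v₀‖ ^ 2 = ‖x - x₀‖ ^ 2 - 2 * inner ℝ (x - x₀) (v₀ - x₀) + ‖x₀ - v₀‖ ^ 2 := by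
    rw [norm_sub_rev x₀ v₀, ← norm_sub_sq_real, sub_sub_sub_cancel_right]
  linarith

theorem isSolution_proj [CompleteSpace H] {I₁ : Finset ι} {g : ι → D → H} {f : ι → D → ℝ}
    {p : D} (hne : (feasibleSet I₁ g f p).Nonempty) (v : H) :
    IsSolution (feasibleSet I₁ g f p) v (proj (feasibleSet I₁ g f p) v) :=
  (isSolution_iff_eq_proj I₁ g f p hne v _).2 rfl

/-- Continuity of the projection at `(p₀, v₀)`. -/
theorem tendsto_proj [CompleteSpace H] [TopologicalSpace D] {I₁ : Finset ι} {g : ι → D → H}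
    {f : ι → D → ℝ} {p₀ : D} {v₀ x₀ : H} (hg : ∀ i, ContinuousAt (g i) p₀)
    (hf : ∀ i, ContinuousAt (f i) p₀) (hlim : x₀ ∈ lowerLimit (feasibleSet I₁ g f) p₀)
    {K : Finset ι} {l : ι → ℝ} (hact : ∀ i ∈ I₁ ∪ K, inner ℝ x₀ (g i p₀) = f i p₀)
    (hl : ∀ i ∈ K, 0 ≤ l i) (hrep : v₀ - x₀ = ∑ i ∈ I₁ ∪ K, l i • g i p₀) :
    Tendsto (fun q : D × H => proj (feasibleSet I₁ g f q.1) (v₀ + q.2)) (𝓝 p₀ ×ˢ 𝓝 0)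
      (𝓝 x₀) := by
  rw [Metric.tendsto_nhds]
  intro δ hδ
  set R := ‖x₀ - v₀‖ with hR
  have hR0 : 0 ≤ R := norm_nonneg _
  -- The `3 * ε` is one `ε` for the feasible point `y` near `x₀` and two for `w`, which enters when
  -- passing from `v₀` to `v₀ + w` and back. The bound `ε ≤ 1` lets `B` dominate `‖x‖`.
  obtain ⟨ε, hε, hε1, hεδ⟩ : ∃ ε : ℝ, 0 < ε ∧ ε ≤ 1 ∧ (R + 3 * ε) ^ 2 - R ^ 2 < δ ^ 2 / 2 := by
    have hc : Tendsto (fun ε : ℝ => (R + 3 * ε) ^ 2 - R ^ 2) (𝓝[>] 0) (𝓝 0) := by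
      have : Continuous fun ε : ℝ => (R + 3 * ε) ^ 2 - R ^ 2 := by fun_prop
      have h := this.tendsto 0
      simp only [mul_zero, add_zero, sub_self] at h
      exact h.mono_left nhdsWithin_le_nhds
    obtain ⟨ε, h1, h2, h3⟩ := ((hc.eventually_lt_const (by positivity : 0 < δ ^ 2 / 2)).and
      (Ioc_mem_nhdsGT (zero_lt_one' ℝ))).exists
    exact ⟨ε, h2, h3, h1⟩
  set B := R + 3 + ‖v₀‖ with hB
  have hsum : ∀ᶠ p in 𝓝 p₀,
      2 * ∑ i ∈ I₁ ∪ K, |l i| * (B * ‖g i p - g i p₀‖ + |f i p - f i p₀|) < δ ^ 2 / 2 := by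
    have hc : ContinuousAt (fun p =>
        2 * ∑ i ∈ I₁ ∪ K, |l i| * (B * ‖g i p - g i p₀‖ + |f i p - f i p₀|)) p₀ := by
      fun_prop
    have h : Tendsto _ _ _ := hc
    simp only [sub_self, norm_zero, abs_zero, mul_zero, add_zero, Finset.sum_const_zero] at h
    exact h.eventually_lt_const (by positivity)
  obtain ⟨U, hU, hUne⟩ := hlim (Metric.ball x₀ ε) (Metric.ball_mem_nhds x₀ hε)
  filter_upwards [prod_mem_prod (inter_mem hU hsum) (Metric.ball_mem_nhds (0 : H) hε)]
  rintro ⟨p, w⟩ ⟨⟨hpU, hps⟩, hw⟩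
  have hps : 2 * ∑ i ∈ I₁ ∪ K, |l i| * (B * ‖g i p - g i p₀‖ + |f i p - f i p₀|) < δ ^ 2 / 2 := hps
  have hw : ‖w‖ < ε := mem_ball_zero_iff.1 hw
  obtain ⟨y, hyx, hyC⟩ := hUne p hpU
  rw [mem_ball_iff_norm] at hyx
  have hsol := (isSolution_iff _ _ _).1 (isSolution_proj ⟨y, hyC⟩ (v₀ + w))
  change dist (proj (feasibleSet I₁ g f p) (v₀ + w)) x₀ < δ
  set x := proj (feasibleSet I₁ g f p) (v₀ + w)
  have h1 : ‖x - v₀‖ ≤ R + 3 * ε := by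
    have e1 : ‖x - v₀‖ ≤ ‖x - (v₀ + w)‖ + ‖w‖ := by
      rw [show x - v₀ = x - (v₀ + w) + w by abel]; exact norm_add_le _ _
    have e2 : ‖y - (v₀ + w)‖ ≤ ‖y - x₀‖ + R + ‖w‖ := by
      rw [show y - (v₀ + w) = (y - x₀) + (x₀ - v₀) - w by abel]
      exact (norm_sub_le _ _).trans (add_le_add (norm_add_le _ _) le_rfl)
    linarith [hsol.2 y hyC]
  have h2 : ‖x‖ ≤ B := by
    have : ‖x‖ ≤ ‖x - v₀‖ + ‖v₀‖ := by
      nth_rewrite 1 [show x = x - v₀ + v₀ by abel]; exact norm_add_le _ _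
    linarith
  have h3 := norm_sub_sq_le_of_mem_feasibleSet hact hl hrep hsol.1
  have h4 : ∑ i ∈ I₁ ∪ K, |l i| * (‖x‖ * ‖g i p - g i p₀‖ + |f i p - f i p₀|) ≤
      ∑ i ∈ I₁ ∪ K, |l i| * (B * ‖g i p - g i p₀‖ + |f i p - f i p₀|) := by
    gcongr
  have h5 : ‖x - v₀‖ ^ 2 ≤ (R + 3 * ε) ^ 2 := pow_le_pow_left₀ (norm_nonneg _) h1 2
  rw [dist_eq_norm]
  refine lt_of_pow_lt_pow_left₀ 2 hδ.le ?_
  linarith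

end Projection

end ParamProj

/-! ### Uniformly bounded multipliers. -/

open ParamProj Filter

theorem proposition3p3
    {H : Type*} [NormedAddCommGroup H] [InnerProductSpace ℝ H] [CompleteSpace H]
    {G : Type*} [NormedAddCommGroup G] [NormedSpace ℝ G] (D : Set G)
    {ι : Type*} [Fintype ι] [DecidableEq ι] (I₁ : Finset ι)
    (g : ι → D → H) (f : ι → D → ℝ)
    (hg : ∀ i, LocallyLipschitz (g i)) (hf : ∀ i, LocallyLipschitz (f i))
    (v₀ : H) (p₀ : D) (x₀ : H)
    (hx₀ : x₀ = ParamProj.proj (ParamProj.feasibleSet I₁ g f p₀) v₀)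
    (hv₀ : v₀ ∉ ParamProj.feasibleSet I₁ g f p₀)
    (hrank : ParamProj.RCRCQ I₁ g f p₀ x₀)
    (hlim : x₀ ∈ ParamProj.lowerLimit (ParamProj.feasibleSet I₁ g f) p₀)
    (K : Finset ι) (hKact : (K : Set ι) ⊆ ParamProj.activeSet g f p₀ x₀) (hKineq : K ⊆ I₁ᶜ)
    (l₀ : ι → ℝ) (hl₀ : ∀ i ∈ K, 0 < l₀ i)
    (hrep : v₀ - x₀ = ∑ i ∈ I₁ ∪ K, l₀ i • g i p₀)
    (hind : LinearIndepOn ℝ (fun i => g i p₀) ((I₁ ∪ K : Finset ι) : Set ι)) :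
    ∃ U ∈ 𝓝 p₀, ∃ V ∈ 𝓝 (0 : H), ∃ M : ℝ, 0 < M ∧ ∀ p ∈ U, ∀ w ∈ V,
      (ParamProj.feasibleSet I₁ g f p).Nonempty ∧
      (ParamProj.boundedMultipliers I₁ g f M (v₀ + w) p
        (ParamProj.proj (ParamProj.feasibleSet I₁ g f p) (v₀ + w))).Nonempty := by
  have hg' : ∀ i, ContinuousAt (g i) p₀ := fun i => (hg i).continuous.continuousAt
  have hf' : ∀ i, ContinuousAt (f i) p₀ := fun i => (hf i).continuous.continuousAt
  obtain ⟨hx₀C, U₀, hU₀, hU₀rank⟩ := hrank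
  have hact : ∀ i ∈ I₁ ∪ K, inner ℝ x₀ (g i p₀) = f i p₀ := fun i hi =>
    (Finset.mem_union.1 hi).elim (hx₀C.1 i) fun h => hKact h
  have hproj := tendsto_proj hg' hf' hlim hact (fun i hi => (hl₀ i hi).le) hrep
  have hI₀ : LinearIndepOn ℝ (fun i => g i p₀) (I₁ : Set ι) :=
    hind.mono (by simp)
  have hbound : ∀ J : Finset ι, ∃ M : ℝ, 0 < M ∧
      (LinearIndepOn ℝ (fun i => g i p₀) (J : Set ι) → ∀ᶠ p in 𝓝 p₀, ∀ l : ι → ℝ,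
        (∀ i ∉ J, l i = 0) → ∑ i, |l i| ≤ M * ‖∑ i, l i • g i p‖) := by
    intro J
    by_cases hJ : LinearIndepOn ℝ (fun i => g i p₀) (J : Set ι)
    · obtain ⟨M, hM, h⟩ := exists_eventually_sum_abs_le hg' hJ
      exact ⟨M, hM, fun _ => h⟩
    -- A dummy value: every `M J` is positive, so the sum over all `J` dominates each of them.
    · exact ⟨1, one_pos, fun h => absurd h hJ⟩
  choose M hM hMbound using hbound
  have hne : ∀ᶠ p in 𝓝 p₀, (feasibleSet I₁ g f p).Nonempty := by
    obtain ⟨U, hU, h⟩ := hlim Set.univ univ_mem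
    filter_upwards [hU] with p hp using (h p hp).mono Set.inter_subset_right
  have hMev : ∀ᶠ p in 𝓝 p₀, ∀ J : Finset ι, LinearIndepOn ℝ (fun i => g i p₀) (J : Set ι) →
      ∀ l : ι → ℝ, (∀ i ∉ J, l i = 0) → ∑ i, |l i| ≤ M J * ‖∑ i, l i • g i p‖ :=
    eventually_all.2 fun J => by
      by_cases hJ : LinearIndepOn ℝ (fun i => g i p₀) (J : Set ι)
      · filter_upwards [hMbound J hJ] with p hp _ using hp
      · exact Eventually.of_forall fun p h => absurd h hJ
  -- By continuity of the projection, constraints inactive at `x₀` stay inactive, so supports found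
  -- near `p₀` fall under the rank condition.
  have hinact : ∀ᶠ q : D × H in 𝓝 p₀ ×ˢ 𝓝 0, ∀ i,
      i ∈ activeSet g f q.1 (proj (feasibleSet I₁ g f q.1) (v₀ + q.2)) →
        i ∈ activeSet g f p₀ x₀ := by
    refine eventually_all.2 fun i => ?_
    by_cases hi : i ∈ activeSet g f p₀ x₀
    · exact Eventually.of_forall fun _ _ => hi
    · have hgt : Tendsto (fun q : D × H => g i q.1) (𝓝 p₀ ×ˢ 𝓝 0) (𝓝 (g i p₀)) :=
        (hg' i).tendsto.comp tendsto_fst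
      have hft : Tendsto (fun q : D × H => f i q.1) (𝓝 p₀ ×ˢ 𝓝 0) (𝓝 (f i p₀)) :=
        (hf' i).tendsto.comp tendsto_fst
      have h := ((hproj.inner hgt).sub hft).eventually_ne (sub_ne_zero.2 hi)
      filter_upwards [h] with q hq hq'
      exact absurd hq' (sub_ne_zero.1 hq)
  have hnorm : ∀ᶠ q : D × H in 𝓝 p₀ ×ˢ 𝓝 0,
      ‖v₀ + q.2 - proj (feasibleSet I₁ g f q.1) (v₀ + q.2)‖ < ‖v₀ - x₀‖ + 1 := by
    have hw : Tendsto (fun q : D × H => v₀ + q.2) (𝓝 p₀ ×ˢ 𝓝 0) (𝓝 (v₀ + 0)) :=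
      tendsto_const_nhds.add tendsto_snd
    rw [add_zero] at hw
    exact (hw.sub hproj).norm.eventually_lt_const (lt_add_one _)
  have hall := (((hne.and (hMev.and hU₀)).prod_inl (𝓝 (0 : H))).and hinact).and hnorm
  obtain ⟨U, hU, V, hV, hUV⟩ := mem_prod_iff.1 hall
  have hR : 0 < ‖v₀ - x₀‖ + 1 := by positivity
  have hMsum : 0 < ∑ J, M J := Finset.sum_pos (fun J _ => hM J) ⟨∅, Finset.mem_univ _⟩
  refine ⟨U, hU, V, hV, (∑ J, M J) * (‖v₀ - x₀‖ + 1), by positivity, fun p hp w hw => ?_⟩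
  obtain ⟨⟨⟨hpne, hpM, hpU₀⟩, hpact⟩, hpnorm⟩ := hUV (Set.mk_mem_prod hp hw)
  dsimp only at hpne hpM hpU₀ hpact hpnorm
  refine ⟨hpne, ?_⟩
  classical
  have hsol := isSolution_proj hpne (v₀ + w)
  set x := proj (feasibleSet I₁ g f p) (v₀ + w)
  let A : Finset ι := Finset.univ.filter fun i => i ∈ activeSet g f p x
  have hA : ∀ i, i ∈ A ↔ i ∈ activeSet g f p x := fun i => by simp [A]
  have hIA : I₁ ⊆ A := fun i hi => (hA i).2 (hsol.1.1 i hi)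
  have hIp : LinearIndepOn ℝ (fun i => g i p) (I₁ : Set ι) :=
    linearIndepOn_of_finrank_eq
      (hU₀rank I₁ subset_rfl (fun i hi => hx₀C.1 i hi) p hpU₀).symm hI₀
  obtain ⟨J, hIJ, hJA, hJ, l, hl, hl', hlv⟩ := exists_linearIndepOn_of_mem_mixedCone hIA hIp
    (sub_mem_mixedCone_of_isSolution hsol hIp hA)
  -- `J` depends on `p` and `w`, but independence at `p₀` makes the fixed constant `M J` applicable.
  have hJ₀ : LinearIndepOn ℝ (fun i => g i p₀) (J : Set ι) :=
    linearIndepOn_of_finrank_eq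
      (hU₀rank J hIJ (fun i hi => hpact i ((hA i).1 (hJA hi))) p hpU₀) hJ
  refine ⟨l, ⟨hlv, fun i hi => ⟨hl' i (Finset.mem_compl.1 hi), ?_⟩⟩, ?_⟩
  · by_cases hiJ : i ∈ J
    · rw [show inner ℝ x (g i p) = f i p from (hA i).1 (hJA hiJ), sub_self, mul_zero]
    · rw [hl i hiJ, zero_mul]
  · calc ∑ i, |l i| ≤ M J * ‖∑ i, l i • g i p‖ := hpM J hJ₀ l hl
      _ = M J * ‖v₀ + w - x‖ := by rw [hlv]
      _ ≤ (∑ J, M J) * (‖v₀ - x₀‖ + 1) := by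
        gcongr
        exact Finset.single_le_sum (fun J _ => (hM J).le) (Finset.mem_univ J)
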